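/- For a finite simple graph $G$ and a vertex $v$, let $N[v]$ be the closed neighbourhood of $v$, consisting of $v$ and all vertices adjacent to $v$. A labeling $f$ of $V(G)$ by positive integers is called vertex sum-distinguishing if $\sum_{x\in N[u]} f(x)\neq \sum_{x\in N[v]} f(x)$ for all vertices $u,v$ with $N[u]\neq N[v]$. Let $s^*(G)$ be the least integer $k$ such that $G$ has a vertex sum-distinguishing labeling with largest label $k$, and let $s^*(n)$ be the maximum of $s^*(G)$ over all graphs $G$ with $n$ vertices. For all real $C>0$ and $\varepsilon>0$ there is $n_0$ such that for every $n>n_0$, $$n^{2-\varepsilon}\le s^*(n)\le \frac{n^2}{C}.$$ In other words, there is a positive function $w$ on the positive integers such that $s^*(n)=n^2/w(n)$ for all $n\ge 1$, $w(n)\to\infty$ as $n\to\infty$, and $w(n)=o(n^{\varepsilon})$ for every $\varepsilon>0$. -/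

import Mathlib

open Filter Asymptotics

namespace SumDistinguishing

variable {V : Type*} [Fintype V]

open Classical in
/-- The closed neighbourhood `N[v]`: the vertex `v` together with all vertices adjacent to it. -/
noncomputable def closedNeighborhood (G : SimpleGraph V) (v : V) : Finset V :=
  {u : V | u = v ∨ G.Adj v u}

/-- The sum of the labels over the closed neighbourhood of `v`. -/
noncomputable def closedSum (G : SimpleGraph V) (f : V → ℕ) (v : V) : ℕ :=
  ∑ x ∈ closedNeighborhood G v, f x

/-- A labeling by positive integers is vertex sum-distinguishing if vertices with different closed
neighbourhoods have different closed neighbourhood sums. -/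
def IsVertexSumDistinguishing (G : SimpleGraph V) (f : V → ℕ) : Prop :=
  (∀ v, 0 < f v) ∧
    ∀ u v, closedNeighborhood G u ≠ closedNeighborhood G v → closedSum G f u ≠ closedSum G f v

/-- `s*(G)`: the least `k` such that `G` has a vertex sum-distinguishing labeling whose largest
label is `k`. -/
noncomputable def sStarGraph (G : SimpleGraph V) : ℕ :=
  sInf {k : ℕ | ∃ f : V → ℕ, IsVertexSumDistinguishing G f ∧ IsGreatest (Set.range f) k}

/-- The minimum defining `s*(G)` is attained as soon as the graph has a vertex. -/
theorem sStarGraph_isLeast [Nonempty V] (G : SimpleGraph V) :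
    IsLeast {k : ℕ | ∃ f : V → ℕ, IsVertexSumDistinguishing G f ∧ IsGreatest (Set.range f) k}
      (sStarGraph G) := by
  refine ⟨Nat.sInf_mem ?_, fun k hk => Nat.sInf_le hk⟩
  let e := Fintype.equivFin V
  let f : V → ℕ := fun v => 2 ^ (e v : ℕ)
  have hfin : (Set.range f).Finite := Set.finite_range f
  obtain ⟨k, hk⟩ := hfin.exists_maximal (Set.range_nonempty f)
  refine ⟨k, f, ⟨fun v => by positivity, fun u v huv hs => huv ?_⟩, hk.prop, ?_⟩
  · let i : V ↪ ℕ := ⟨fun v => (e v : ℕ), fun a b h => e.injective (Fin.ext h)⟩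
    apply Finset.map_injective i
    apply Finset.geomSum_injective (n := 2) le_rfl
    simp only [Finset.sum_map]
    exact hs
  · intro y hy
    rcases le_total y k with h | h
    · exact h
    · exact hk.le_of_ge hy h

open Classical in
/-- `s*(n)`: the maximum of `s*(G)` over all graphs `G` on `n` vertices. -/
noncomputable def sStar (n : ℕ) : ℕ :=
  (Finset.univ : Finset (SimpleGraph (Fin n))).sup sStarGraph

end SumDistinguishing

/-! Lower bound. On k points, k of order log n, labels at most N give at most R = kN + 1 subset
sums. Colour 3R subsets randomly with q colours. Each labeling yields R disjoint colliding pairs, so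
a given colour class is collision-free with probability at most (1 - 1/q²)^R. A union bound over
labelings and colours gives a colouring in which every class has a collision for every labeling, and
some class has at most 3R/q members (`exists_family_forall_collision`). With q about 6R/n this works
for N about n^(2-ε); making the class a clique, each member joined to its elements, gives the graph
(`lt_sStar_of_family`).

Upper bound. With 2M ≈ n²/C random labels the n² pairs have about C expected collisions, so a plain
union bound fails. Pairs are split by the size of the symmetric difference of their neighbourhoods.
Large differences collide with probability o(1/M), by anti-concentration of signed bit sums. Middle
sizes are rare on one of T geometric scales. All small differences are avoided at once with
probability at least e^(-4C): labels are chosen in turn, with at most M of the 2M values forbidden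
each time. The few elements in too many small differences receive powers of two beforehand. The
constants keep the first two failure probabilities together below e^(-4C)
(`exists_labeling_distinct_sums`). -/

namespace SumDistinguishing

/-! ### Lower bound: small families with unavoidable collisions -/

open Classical in
/-- If `g` takes at most `R` values on a set of `R + 2 t` elements, then there are few `q`-colourings
for which `g` is injective on the colour class of `j`. -/
theorem card_colourings_injOn_class_le {β : Type} [Fintype β] {q : ℕ} (j : Fin q) (t : ℕ) :
    ∀ (U : Type) [Fintype U] (g : U → β), Fintype.card U = Fintype.card β + 2 * t →
      (Finset.univ.filter fun c : U → Fin q => Set.InjOn g {x | c x = j}).card ≤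
        q ^ Fintype.card β * (q ^ 2 - 1) ^ t := by
  induction t with
  | zero =>
    intro U _ g hU
    refine (Finset.card_le_univ _).trans ?_
    simp [hU]
  | succ t ih =>
    intro U _ g hU
    -- A colliding pair cannot both receive colour `j`, which leaves q² - 1 colourings of the pair;
    -- delete it and induct.
    obtain ⟨u, u', huu, hg⟩ := Fintype.exists_ne_map_eq_of_card_lt g (by omega)
    let W := {x : U // x ≠ u ∧ x ≠ u'}
    have hW : Fintype.card W = Fintype.card β + 2 * t := by
      have h1 : Fintype.card W = (({u, u'} : Finset U)ᶜ).card := by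
        rw [Fintype.card_subtype]
        congr 1
        ext x
        simp
      rw [h1, Finset.card_compl, Finset.card_pair huu]
      omega
    have key := ih W (fun x => g x) hW
    set A := Finset.univ.filter fun c : W → Fin q => Set.InjOn (fun x : W => g x) {x | c x = j}
    have hcard : ((({(j, j)} : Finset (Fin q × Fin q))ᶜ) ×ˢ A).card ≤
        (q ^ 2 - 1) * (q ^ Fintype.card β * (q ^ 2 - 1) ^ t) := by
      rw [Finset.card_product, Finset.card_compl]
      simp only [Fintype.card_prod, Fintype.card_fin, Finset.card_singleton]
      rw [← sq]
      refine Nat.mul_le_mul_left _ ?_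
      convert key
    have hle : (Finset.univ.filter fun c : U → Fin q => Set.InjOn g {x | c x = j}).card ≤
        ((({(j, j)} : Finset (Fin q × Fin q))ᶜ) ×ˢ A).card := by
      apply Finset.card_le_card_of_injOn (fun c => ((c u, c u'), fun x : W => c x))
      · intro c hc
        simp only [Finset.coe_filter, Finset.mem_univ, true_and, Set.mem_ofPred_eq] at hc
        simp only [Finset.coe_product, Set.mem_prod, Finset.mem_coe, Finset.mem_compl,
          Finset.mem_singleton, Prod.mk.injEq, A, Finset.mem_filter, Finset.mem_univ, true_and]
        refine ⟨fun h => huu (hc h.1 h.2 hg), fun x hx y hy hxy => ?_⟩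
        exact Subtype.ext (hc hx hy hxy)
      · intro c _ c' _ h
        simp only [Prod.mk.injEq] at h
        funext x
        by_cases hx : x = u
        · rw [hx]; exact h.1.1
        by_cases hx' : x = u'
        · rw [hx']; exact h.1.2
        exact congrFun h.2 ⟨x, hx, hx'⟩
    refine (hle.trans hcard).trans (le_of_eq ?_)
    ring

/-- A small family of subsets of `Fin k` on which every labeling by `0, …, N` has two equal sums. -/
theorem exists_family_forall_collision {k N q : ℕ} (hq : 0 < q)
    (hk : 3 * (k * N + 1) ≤ 2 ^ k)
    (h : (N + 1) ^ k * q * (q ^ 2 - 1) ^ (k * N + 1) < (q ^ 2) ^ (k * N + 1)) :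
    ∃ F : Finset (Finset (Fin k)), q * F.card ≤ 3 * (k * N + 1) ∧
      ∀ f : Fin k → ℕ, (∀ i, f i ≤ N) →
        ∃ e ∈ F, ∃ e' ∈ F, e ≠ e' ∧ ∑ x ∈ e, f x = ∑ x ∈ e', f x := by
  classical
  set R := k * N + 1 with hR
  -- 3R = R + 2·R: enough to extract R disjoint colliding pairs from R possible sums.
  obtain ⟨U, -, hU⟩ := Finset.exists_subset_card_eq
    (s := (Finset.univ : Finset (Finset (Fin k)))) (n := 3 * R) (by simpa using hk)
  have hbound : ∀ (f : Fin k → Fin (N + 1)) (e : Finset (Fin k)), ∑ x ∈ e, (f x : ℕ) < R := by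
    intro f e
    have h1 : ∑ x ∈ e, (f x : ℕ) ≤ e.card * N := by
      rw [← smul_eq_mul]
      exact Finset.sum_le_card_nsmul _ _ _ fun x _ => by have := (f x).2; omega
    have h2 : e.card ≤ k := by simpa using Finset.card_le_univ e
    have := Nat.mul_le_mul_right N h2
    omega
  let g : (Fin k → Fin (N + 1)) → U → Fin R := fun f e => ⟨∑ x ∈ e.1, (f x : ℕ), hbound f e.1⟩
  let Bad : (Fin k → Fin (N + 1)) × Fin q → Finset (U → Fin q) := fun p =>
    Finset.univ.filter fun c => Set.InjOn (g p.1) {x | c x = p.2}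
  have hbad : ∀ p, (Bad p).card ≤ q ^ R * (q ^ 2 - 1) ^ R := by
    intro p
    have := card_colourings_injOn_class_le p.2 R U (g p.1) (by simp [hU]; omega)
    simp only [Fintype.card_fin] at this
    convert this
  have hlt : (Finset.univ.biUnion Bad).card < Fintype.card (U → Fin q) := by
    refine lt_of_le_of_lt (Finset.card_biUnion_le_card_mul _ _ _ fun p _ => hbad p) ?_
    simp only [Finset.card_univ, Fintype.card_prod, Fintype.card_pi, Fintype.card_fin,
      Finset.prod_const, Fintype.card_coe, hU]
    calc (N + 1) ^ k * q * (q ^ R * (q ^ 2 - 1) ^ R)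
        = q ^ R * ((N + 1) ^ k * q * (q ^ 2 - 1) ^ R) := by ring
      _ < q ^ R * (q ^ 2) ^ R := Nat.mul_lt_mul_of_pos_left h (by positivity)
      _ = q ^ (3 * R) := by ring
  obtain ⟨c, hc⟩ : ∃ c, c ∉ Finset.univ.biUnion Bad := by
    by_contra hcon
    push Not at hcon
    rw [(Finset.eq_univ_iff_forall).2 hcon, Finset.card_univ] at hlt
    exact lt_irrefl _ hlt
  have hc' : ∀ f j, ¬ Set.InjOn (g f) {x | c x = j} := by
    intro f j hinj
    exact hc (Finset.mem_biUnion.2 ⟨(f, j), Finset.mem_univ _, by simpa [Bad] using hinj⟩)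
  have : Nonempty (Fin q) := ⟨⟨0, hq⟩⟩
  obtain ⟨j, hj⟩ : ∃ j : Fin q, q * (Finset.univ.filter fun x => c x = j).card ≤ 3 * R := by
    by_contra hcon
    push Not at hcon
    have h1 : ∑ j : Fin q, (Finset.univ.filter fun x => c x = j).card = 3 * R := by
      rw [← Finset.card_eq_sum_card_fiberwise (fun x _ => Finset.mem_univ (c x))]
      simp [hU]
    have h2 : ∑ _j : Fin q, 3 * R < ∑ j : Fin q, q * (Finset.univ.filter fun x => c x = j).card :=
      Finset.sum_lt_sum_of_nonempty Finset.univ_nonempty fun j _ => hcon j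
    rw [← Finset.mul_sum (f := fun j => (Finset.univ.filter fun x => c x = j).card), h1] at h2
    simp at h2
  refine ⟨(Finset.univ.filter fun x => c x = j).map (Function.Embedding.subtype _), ?_, ?_⟩
  · rwa [Finset.card_map]
  · intro f hf
    have := hc' (fun i => ⟨f i, Nat.lt_succ_of_le (hf i)⟩) j
    simp only [Set.InjOn, not_forall] at this
    obtain ⟨e, he, e', he', heq, hne⟩ := this
    refine ⟨e, ?_, e', ?_, fun h => hne (Subtype.ext h), ?_⟩
    · simp only [Finset.mem_map, Finset.mem_filter, Finset.mem_univ, true_and]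
      exact ⟨e, he, rfl⟩
    · simp only [Finset.mem_map, Finset.mem_filter, Finset.mem_univ, true_and]
      exact ⟨e', he', rfl⟩
    · simpa [g] using heq

/-! ### Lower bound: from set families to graphs -/

/-- The graph of a set family `F` on `α`: the members of `F` form a clique, and each of them is
adjacent to its elements. -/
def familyGraph {α : Type} (F : Finset (Finset α)) : SimpleGraph (α ⊕ F) where
  Adj
    | .inl _, .inl _ => False
    | .inl x, .inr e => x ∈ e.1
    | .inr e, .inl x => x ∈ e.1
    | .inr e, .inr e' => e ≠ e'
  symm := ⟨by
    rintro (x | e) (y | e') h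
    · exact h
    · exact h
    · exact h
    · exact Ne.symm h⟩
  loopless := ⟨by
    rintro (x | e) h
    · exact h
    · exact h rfl⟩

theorem mem_closedNeighborhood {V : Type*} [Fintype V] (G : SimpleGraph V) (u v : V) :
    u ∈ closedNeighborhood G v ↔ u = v ∨ G.Adj v u := by
  simp [closedNeighborhood]

theorem closedNeighborhood_map {W V : Type} [Fintype W] [Fintype V] (G : SimpleGraph W)
    (i : W ↪ V) (w : W) :
    closedNeighborhood (G.map i) (i w) = (closedNeighborhood G w).map i := by
  ext v
  simp only [mem_closedNeighborhood, Finset.mem_map,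
    SimpleGraph.map_adj]
  constructor
  · rintro (rfl | ⟨a, b, hab, ha, rfl⟩)
    · exact ⟨w, Or.inl rfl, rfl⟩
    · rw [i.injective ha] at hab
      exact ⟨b, Or.inr hab, rfl⟩
  · rintro ⟨a, rfl | ha, rfl⟩
    · exact Or.inl rfl
    · exact Or.inr ⟨w, a, ha, rfl, rfl⟩

theorem closedNeighborhood_familyGraph {α : Type} [Fintype α] (F : Finset (Finset α)) (e : F) :
    closedNeighborhood (familyGraph F) (.inr e) = e.1.disjSum Finset.univ := by
  classical
  ext (x | e')
  · simp [mem_closedNeighborhood, familyGraph]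
  · simp only [mem_closedNeighborhood, familyGraph, Sum.inr.injEq, Finset.inr_mem_disjSum,
      Finset.mem_univ, iff_true]
    tauto

theorem sStarGraph_le_sStar {n : ℕ} (G : SimpleGraph (Fin n)) : sStarGraph G ≤ sStar n := by
  classical
  exact Finset.le_sup (f := sStarGraph) (Finset.mem_univ G)

/-- Every clique vertex sees the whole clique, so the clique labels cancel and only the sums over
members of `F` matter. The unused vertices of `Fin n` stay isolated. -/
theorem lt_sStar_of_family {k N n : ℕ} (F : Finset (Finset (Fin k))) (hn : k + F.card ≤ n)
    (hpos : 0 < n)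
    (hF : ∀ f : Fin k → ℕ, (∀ i, f i ≤ N) →
      ∃ e ∈ F, ∃ e' ∈ F, e ≠ e' ∧ ∑ x ∈ e, f x = ∑ x ∈ e', f x) : N < sStar n := by
  classical
  obtain ⟨i⟩ : Nonempty (Fin k ⊕ F ↪ Fin n) :=
    Function.Embedding.nonempty_of_card_le (by simpa using hn)
  let G := (familyGraph F).map i
  have : Nonempty (Fin n) := ⟨⟨0, hpos⟩⟩
  refine lt_of_lt_of_le ?_ (sStarGraph_le_sStar G)
  obtain ⟨f, ⟨-, hf⟩, hmax⟩ := (sStarGraph_isLeast G).1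
  by_contra! hle
  obtain ⟨e, he, e', he', hne, hsum⟩ := hF (fun x => f (i (.inl x)))
    fun x => (hmax.2 (Set.mem_range_self _)).trans hle
  refine hf (i (.inr ⟨e, he⟩)) (i (.inr ⟨e', he'⟩)) ?_ ?_
  · simp only [G, closedNeighborhood_map, closedNeighborhood_familyGraph]
    intro h
    apply hne
    have h' := Finset.map_injective i h
    ext x
    have := congrArg (fun s => Sum.inl x ∈ s) h'
    simpa using this
  · simp only [closedSum, G, closedNeighborhood_map, closedNeighborhood_familyGraph,
      Finset.sum_map, Finset.sum_disjSum, hsum]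

/-! ### Lower bound: choice of parameters -/

theorem mul_pred_pow_lt_of_lt_exp {a q R : ℕ} (hq : 0 < q)
    (h : (a : ℝ) < Real.exp (R / (q : ℝ) ^ 2)) : a * (q ^ 2 - 1) ^ R < (q ^ 2) ^ R := by
  have hq' : (0 : ℝ) < (q : ℝ) ^ 2 := by positivity
  have hq1 : 1 ≤ q ^ 2 := Nat.one_le_pow _ _ hq
  have h1 : ((q : ℝ) ^ 2 - 1) ^ R ≤ ((q : ℝ) ^ 2) ^ R * Real.exp (-(R / (q : ℝ) ^ 2)) := by
    have h2 : (q : ℝ) ^ 2 - 1 ≤ (q : ℝ) ^ 2 * Real.exp (-(1 / (q : ℝ) ^ 2)) := by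
      have := Real.add_one_le_exp (-(1 / (q : ℝ) ^ 2))
      calc (q : ℝ) ^ 2 - 1 = (q : ℝ) ^ 2 * (-(1 / (q : ℝ) ^ 2) + 1) := by field_simp; ring
        _ ≤ _ := by gcongr
    have h3 : (0 : ℝ) ≤ (q : ℝ) ^ 2 - 1 := by
      have : (1 : ℝ) ≤ (q : ℝ) ^ 2 := by exact_mod_cast hq1
      linarith
    calc ((q : ℝ) ^ 2 - 1) ^ R ≤ ((q : ℝ) ^ 2 * Real.exp (-(1 / (q : ℝ) ^ 2))) ^ R := by gcongr
      _ = _ := by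
        rw [mul_pow, ← Real.exp_nat_mul]
        congr 2
        ring
  have h4 : (a : ℝ) * ((q : ℝ) ^ 2 - 1) ^ R < ((q : ℝ) ^ 2) ^ R := by
    calc (a : ℝ) * ((q : ℝ) ^ 2 - 1) ^ R
        ≤ a * (((q : ℝ) ^ 2) ^ R * Real.exp (-(R / (q : ℝ) ^ 2))) := by gcongr
      _ < Real.exp (R / (q : ℝ) ^ 2) * (((q : ℝ) ^ 2) ^ R * Real.exp (-(R / (q : ℝ) ^ 2))) := by
        gcongr
      _ = ((q : ℝ) ^ 2) ^ R * Real.exp (R / (q : ℝ) ^ 2 + -(R / (q : ℝ) ^ 2)) := by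
        rw [Real.exp_add]; ring
      _ = _ := by simp
  have : ((a * (q ^ 2 - 1) ^ R : ℕ) : ℝ) < (((q ^ 2) ^ R : ℕ) : ℝ) := by
    push_cast [hq1]
    exact h4
  exact_mod_cast this

theorem eventually_log_pow_mul_lt_rpow (a : ℝ) (ha : 0 < a) (j : ℕ) {ε : ℝ} (hε : 0 < ε) :
    ∀ᶠ n : ℕ in atTop, a * Real.log n ^ j < (n : ℝ) ^ ε := by
  have h := (isLittleO_log_rpow_rpow_atTop (j : ℝ) hε).comp_tendsto tendsto_natCast_atTop_atTop
  have h2 := h.def (c := 1 / (2 * a)) (by positivity)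
  filter_upwards [h2, eventually_ge_atTop 1] with n hn h1
  have hn1 : (1 : ℝ) ≤ n := by exact_mod_cast h1
  have hlog := Real.log_nonneg hn1
  have hpos : (0 : ℝ) < (n : ℝ) ^ ε := Real.rpow_pos_of_pos (by linarith) _
  simp only [Function.comp, Real.rpow_natCast, Real.norm_eq_abs, abs_of_pos hpos,
    abs_of_nonneg (pow_nonneg hlog j)] at hn
  calc a * Real.log n ^ j ≤ a * (1 / (2 * a) * (n : ℝ) ^ ε) := by gcongr
    _ = (n : ℝ) ^ ε / 2 := by field_simp
    _ < _ := by linarith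

theorem eventually_rpow_le_sStar {ε : ℝ} (hε : 0 < ε) (hε1 : ε ≤ 1) :
    ∀ᶠ n : ℕ in atTop, (n : ℝ) ^ (2 - ε) ≤ (sStar n : ℝ) := by
  -- 32340 = 33·980 comes from comparing 33 L² with n^ε/(980 L) below; 20 L < n gives 2k ≤ n, as k ≤
  -- 10 L.
  filter_upwards [eventually_log_pow_mul_lt_rpow 32340 (by norm_num) 3 hε,
    eventually_log_pow_mul_lt_rpow 20 (by norm_num) 1 one_pos, eventually_ge_atTop 8]
    with n hmain hlin hn8
  have hn8' : (8 : ℝ) ≤ n := by exact_mod_cast hn8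
  have hn0 : (0 : ℝ) < n := by linarith
  have hL : 1 ≤ Real.log n := by
    rw [Real.le_log_iff_exp_le hn0]
    linarith [Real.exp_one_lt_d9]
  set L := Real.log n with hLdef
  simp only [Real.rpow_one, pow_one] at hlin
  -- This makes 2^k ≥ n⁴, room for 3R subsets, while k stays logarithmic.
  set k := 4 * (Nat.log 2 n + 1) with hk
  have hkL : (k : ℝ) ≤ 10 * L := by
    have h1 : ((2 : ℝ)) ^ Nat.log 2 n ≤ n := by
      exact_mod_cast Nat.pow_log_le_self 2 (by omega)
    have h2 := Real.log_le_log (by positivity) h1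
    rw [Real.log_pow] at h2
    have h3 := Real.log_two_gt_d9
    have h5 : (0 : ℝ) ≤ (Nat.log 2 n : ℝ) := by positivity
    have h4 : (Nat.log 2 n : ℝ) * 0.69 ≤ L := by nlinarith
    rw [hk]
    push_cast
    linarith
  have hkpos : 1 ≤ k := by omega
  have hkpos' : (1 : ℝ) ≤ k := by exact_mod_cast hkpos
  have h2k : 2 * k ≤ n := by
    have : (2 * k : ℝ) ≤ n := by linarith
    exact_mod_cast this
  have h2k' : (2 * k : ℝ) ≤ n := by exact_mod_cast h2k
  set N := ⌊(n : ℝ) ^ (2 - ε)⌋₊ with hN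
  have hNle : (N : ℝ) ≤ (n : ℝ) ^ (2 - ε) := Nat.floor_le (by positivity)
  have hNsq : (N : ℝ) ≤ (n : ℝ) ^ 2 := by
    refine hNle.trans ?_
    rw [← Real.rpow_natCast]
    exact Real.rpow_le_rpow_of_exponent_le (by linarith) (by push_cast; linarith)
  have hNn : n ≤ N := by
    refine Nat.le_floor ?_
    conv_lhs => rw [← Real.rpow_one (n : ℝ)]
    exact Real.rpow_le_rpow_of_exponent_le (by linarith) (by linarith)
  have hNn' : (n : ℝ) ≤ N := by exact_mod_cast hNn
  set R := k * N + 1 with hR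
  have hRr : (R : ℝ) = k * N + 1 := by rw [hR]; push_cast; ring
  have hRn : (n : ℝ) ≤ R := by rw [hRr]; nlinarith
  have hR0 : (0 : ℝ) < R := by linarith
  have hR2 : (R : ℝ) ≤ 2 * k * N := by rw [hRr]; nlinarith
  -- Chosen so that 3R/q < n/2; the other half of the vertices accommodates the k points.
  set q := 6 * R / n + 1 with hq
  have hqn : 6 * R < n * q := by
    rw [hq]
    exact Nat.lt_mul_div_succ _ (by omega)
  have hqle : (q : ℝ) ≤ 7 * R / n := by
    have h1 : ((6 * R / n : ℕ) : ℝ) ≤ ((6 * R : ℕ) : ℝ) / n := Nat.cast_div_le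
    have h2 : (1 : ℝ) ≤ R / n := by rwa [le_div_iff₀ hn0, one_mul]
    have h3 : ((6 * R : ℕ) : ℝ) / n = 6 * (R / n) := by push_cast; ring
    rw [hq]
    push_cast at h1 ⊢
    push_cast at h3
    rw [h3] at h1
    rw [mul_div_assoc]
    linarith
  have hq0 : 0 < q := Nat.succ_pos _
  have hq0' : (0 : ℝ) < q := by exact_mod_cast hq0
  have hfam : 3 * (k * N + 1) ≤ 2 ^ k := by
    have h1 : n ^ 4 ≤ 2 ^ k := by
      have : n ≤ 2 ^ (Nat.log 2 n + 1) := (Nat.lt_pow_succ_log_self (by norm_num) n).le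
      calc n ^ 4 ≤ (2 ^ (Nat.log 2 n + 1)) ^ 4 := Nat.pow_le_pow_left this 4
        _ = 2 ^ k := by rw [← pow_mul, hk, mul_comm]
    have hNsqn : N ≤ n ^ 2 := by exact_mod_cast hNsq
    have h2 : 2 * k * N ≤ n * n ^ 2 := Nat.mul_le_mul h2k hNsqn
    have h3 : 8 * (n * n ^ 2) ≤ n ^ 4 := by
      calc 8 * (n * n ^ 2) ≤ n * (n * n ^ 2) := Nat.mul_le_mul_right _ hn8
        _ = n ^ 4 := by ring
    have h4 : 1 ≤ n * n ^ 2 := by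
      have : 0 < n * n ^ 2 := by positivity
      omega
    have h5 : 2 * (k * N) = 2 * k * N := by ring
    omega
  have hexp : (((N + 1) ^ k * q : ℕ) : ℝ) < Real.exp (R / (q : ℝ) ^ 2) := by
    rw [← Real.log_lt_iff_lt_exp (by positivity)]
    push_cast
    rw [Real.log_mul (by positivity) (by positivity), Real.log_pow]
    have hN3 : Real.log ((N : ℝ) + 1) ≤ 3 * L := by
      have : Real.log ((N : ℝ) + 1) ≤ Real.log ((n : ℝ) ^ 3) :=
        Real.log_le_log (by positivity) (by nlinarith [pow_pos hn0 2])
      rwa [Real.log_pow] at this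
    have hq3 : Real.log q ≤ 3 * L := by
      have h7 : (q : ℝ) ≤ (n : ℝ) ^ 3 := by
        refine hqle.trans ?_
        rw [div_le_iff₀ hn0]
        have : (2 * k : ℝ) * N ≤ n * (n : ℝ) ^ 2 := by gcongr
        nlinarith [pow_pos hn0 3]
      have : Real.log q ≤ Real.log ((n : ℝ) ^ 3) := Real.log_le_log hq0' h7
      rwa [Real.log_pow] at this
    have hlow : (n : ℝ) ^ ε / (980 * L) ≤ R / (q : ℝ) ^ 2 := by
      have h1 : (n : ℝ) ^ 2 / (49 * R) ≤ R / (q : ℝ) ^ 2 := by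
        have : (R : ℝ) / (7 * R / n) ^ 2 ≤ R / (q : ℝ) ^ 2 := by gcongr
        refine le_trans (le_of_eq ?_) this
        field_simp
        norm_num
      have h2 : (R : ℝ) ≤ 20 * L * (n : ℝ) ^ (2 - ε) := by
        calc (R : ℝ) ≤ 2 * k * N := hR2
          _ ≤ 2 * (10 * L) * (n : ℝ) ^ (2 - ε) := by gcongr
          _ = _ := by ring
      refine le_trans ?_ h1
      have hsplit : (n : ℝ) ^ ε * (n : ℝ) ^ (2 - ε) = (n : ℝ) ^ 2 := by
        rw [← Real.rpow_add hn0, ← Real.rpow_natCast]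
        congr 1
        push_cast
        ring
      rw [div_le_div_iff₀ (by positivity) (by positivity), ← hsplit]
      calc (n : ℝ) ^ ε * (49 * R) ≤ (n : ℝ) ^ ε * (49 * (20 * L * (n : ℝ) ^ (2 - ε))) := by gcongr
        _ = _ := by ring
    refine lt_of_lt_of_le ?_ hlow
    rw [lt_div_iff₀ (by positivity)]
    have h1 : (k : ℝ) * Real.log ((N : ℝ) + 1) ≤ 10 * L * (3 * L) :=
      mul_le_mul hkL hN3 (Real.log_nonneg (by linarith)) (by linarith)
    have h2 : (k : ℝ) * Real.log ((N : ℝ) + 1) + Real.log q ≤ 33 * L ^ 2 := by nlinarith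
    calc _ ≤ 33 * L ^ 2 * (980 * L) := by gcongr
      _ = 32340 * L ^ 3 := by ring
      _ < _ := hmain
  obtain ⟨F, hFcard, hF⟩ := exists_family_forall_collision hq0 hfam
    (mul_pred_pow_lt_of_lt_exp hq0 hexp)
  have hcard : k + F.card ≤ n := by
    have h1 : q * (2 * F.card) < q * n := by
      calc q * (2 * F.card) = 2 * (q * F.card) := by ring
        _ ≤ 6 * R := by omega
        _ < q * n := by rw [mul_comm q]; exact hqn
    have := Nat.lt_of_mul_lt_mul_left h1
    omega
  have hlt : N < sStar n := lt_sStar_of_family F hcard (by omega) hF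
  have h1 : (n : ℝ) ^ (2 - ε) < N + 1 := Nat.lt_floor_add_one _
  have h2 : ((N + 1 : ℕ) : ℝ) ≤ sStar n := by exact_mod_cast hlt
  push_cast at h2
  linarith

/-! ### Upper bound: counting labelings -/

/-- Choosing values one after another, with at most `a v` values forbidden at `v` by the earlier
choices, leaves at least `∏ (|A| - a v)` functions. -/
theorem prod_sub_le_card_avoiding {V A : Type} [Fintype V] [LinearOrder V] [Fintype A]
    [DecidableEq A] [Nonempty A] (B : V → (V → A) → Finset A) (a : V → ℕ)
    (hB : ∀ v g g', (∀ x < v, g x = g' x) → B v g = B v g')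
    (ha : ∀ v g, (B v g).card ≤ a v) :
    ∏ v, (Fintype.card A - a v) ≤
      (Finset.univ.filter fun g : V → A => ∀ v, g v ∉ B v g).card := by
  set N := Fintype.card A with hN
  have hN0 : 0 < N := Fintype.card_pos
  -- The proportion of functions good on `s` is at least ∏ (1 - a v/N). Adding maximal elements
  -- means that resampling at `j` leaves the earlier constraints intact.
  have key : ∀ s : Finset V, N ^ Fintype.card V * ∏ v ∈ s, (N - a v) ≤
      (Finset.univ.filter fun g : V → A => ∀ v ∈ s, g v ∉ B v g).card * N ^ s.card := by
    intro s
    induction s using Finset.induction_on_max with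
    | empty => simp [hN]
    | insert j s hj ih =>
      have hjs : j ∉ s := fun h => lt_irrefl _ (hj j h)
      have hdep : ∀ (g : V → A) (b : A), ∀ v ∈ insert j s, B v (Function.update g j b) = B v g := by
        intro g b v hv
        refine hB v _ _ fun x hx => Function.update_of_ne (ne_of_lt ?_) _ _
        rcases Finset.mem_insert.1 hv with rfl | hv
        · exact hx
        · exact hx.trans (hj v hv)
      set G := Finset.univ.filter fun g : V → A => ∀ v ∈ s, g v ∉ B v g with hG
      set G' := Finset.univ.filter fun g : V → A => ∀ v ∈ insert j s, g v ∉ B v g with hG'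
      have hstep : G.card * (N - a j) ≤ G'.card * N := by
        have h1 : G.card * (N - a j) ≤ (G.sigma fun g => (B j g)ᶜ).card := by
          rw [Finset.card_sigma, ← smul_eq_mul]
          refine Finset.card_nsmul_le_sum _ _ _ fun g _ => ?_
          rw [Finset.card_compl]
          exact Nat.sub_le_sub_left (ha j g) _
        -- The second coordinate keeps the overwritten value, which makes the resampling map
        -- injective.
        have h2 : (G.sigma fun g => (B j g)ᶜ).card ≤ (G' ×ˢ (Finset.univ : Finset A)).card := by
          apply Finset.card_le_card_of_injOn
            (fun p : (Σ _ : V → A, A) => (Function.update p.1 j p.2, p.1 j))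
          · rintro ⟨g, b⟩ h
            simp only [Finset.coe_sigma, Set.mem_sigma_iff, Finset.mem_coe, hG,
              Finset.mem_filter, Finset.mem_univ, true_and, Finset.mem_compl] at h
            simp only [Finset.coe_product, Finset.coe_univ, Set.mem_prod, Finset.mem_coe, hG',
              Finset.mem_filter, Finset.mem_univ, true_and, Set.mem_univ, and_true]
            intro v hv
            rw [hdep g b v hv]
            rcases Finset.mem_insert.1 hv with rfl | hv'
            · simpa using h.2
            · rw [Function.update_of_ne (ne_of_lt (hj v hv'))]
              exact h.1 v hv'
          · rintro ⟨g, b⟩ _ ⟨g', b'⟩ _ h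
            simp only [Prod.mk.injEq] at h
            have hb : b = b' := by simpa using congrFun h.1 j
            have hg : g = g' := by
              have := congrArg (fun u => Function.update u j (g j)) h.1
              simp only [Function.update_idem, Function.update_eq_self] at this
              exact this.trans (by rw [h.2, Function.update_eq_self])
            rw [hb, hg]
        rw [Finset.card_product, Finset.card_univ] at h2
        exact h1.trans h2
      rw [Finset.prod_insert hjs, Finset.card_insert_of_notMem hjs, pow_succ]
      calc N ^ Fintype.card V * ((N - a j) * ∏ v ∈ s, (N - a v))
          = (N ^ Fintype.card V * ∏ v ∈ s, (N - a v)) * (N - a j) := by ring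
        _ ≤ (G.card * N ^ s.card) * (N - a j) := Nat.mul_le_mul_right _ ih
        _ = (G.card * (N - a j)) * N ^ s.card := by ring
        _ ≤ (G'.card * N) * N ^ s.card := Nat.mul_le_mul_right _ hstep
        _ = _ := by ring
  have h := key Finset.univ
  rw [Finset.card_univ, mul_comm] at h
  simpa using Nat.le_of_mul_le_mul_right h (by positivity)

/-- A set of functions in which the value at `x₀` is determined by the other values. -/
theorem card_mul_card_le_of_determined {V A : Type} [Fintype V] [DecidableEq V] [Fintype A]
    (S : Finset (V → A)) (x₀ : V)
    (hS : ∀ g ∈ S, ∀ g' ∈ S, (∀ x ≠ x₀, g x = g' x) → g x₀ = g' x₀) :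
    S.card * Fintype.card A ≤ Fintype.card A ^ Fintype.card V := by
  classical
  have h : (S ×ˢ (Finset.univ : Finset A)).card ≤ (Finset.univ : Finset (V → A)).card := by
    apply Finset.card_le_card_of_injOn (fun p => Function.update p.1 x₀ p.2)
      (fun _ _ => Finset.mem_coe.2 (Finset.mem_univ _))
    rintro ⟨g, b⟩ hg ⟨g', b'⟩ hg' h
    simp only [Finset.coe_product, Set.mem_prod, Finset.mem_coe] at hg hg' h
    have hb : b = b' := by simpa using congrFun h x₀
    have hoff : ∀ x ≠ x₀, g x = g' x := fun x hx => by
      simpa [Function.update_of_ne hx] using congrFun h x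
    have hg₀ := hS g hg.1 g' hg'.1 hoff
    have : g = g' := funext fun x => by
      by_cases hx : x = x₀
      · rw [hx, hg₀]
      · exact hoff x hx
    rw [hb, this]
  simpa using h

theorem linear_determined {V : Type} [Fintype V] [DecidableEq V] (c : V → ℤ) (x₀ : V)
    (z z' : V → ℤ) (hoff : ∀ x ≠ x₀, z x = z' x) :
    ∑ x, c x * z x - ∑ x, c x * z' x = c x₀ * (z x₀ - z' x₀) := by
  rw [← Finset.sum_sub_distrib, Finset.sum_eq_single x₀]
  · ring
  · intro x _ hx
    rw [hoff x hx]; ring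
  · simp

/-! ### Upper bound: anti-concentration of one equation -/

/-- The label encoded by a pair of a bit and a residue; these pairs encode `1, …, 2 M`. -/
def labelValue {M : ℕ} (a : Bool × Fin M) : ℕ := a.2 + 1 + M * a.1.toNat

theorem labelValue_pos {M : ℕ} (a : Bool × Fin M) : 0 < labelValue a := by
  simp [labelValue]

theorem labelValue_le {M : ℕ} (a : Bool × Fin M) : labelValue a ≤ 2 * M := by
  obtain ⟨b, y⟩ := a
  have := y.2
  cases b <;> simp [labelValue] <;> omega

theorem labelValue_injective {M : ℕ} : Function.Injective (labelValue (M := M)) := by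
  rintro ⟨b, y⟩ ⟨b', y'⟩ h
  have h1 := y.2
  have h2 := y'.2
  cases b <;> cases b' <;> simp [labelValue] at h ⊢ <;> omega

theorem card_linear_eq_le {V : Type} [Fintype V] [DecidableEq V] {M : ℕ} (c : V → ℤ) (t : ℤ) {x₀ : V}
    (hx₀ : c x₀ ≠ 0) :
    (Finset.univ.filter fun g : V → Bool × Fin M =>
      ∑ x, c x * (labelValue (g x) : ℤ) = t).card * (2 * M) ≤ (2 * M) ^ Fintype.card V := by
  classical
  have := card_mul_card_le_of_determined (Finset.univ.filter fun g : V → Bool × Fin M =>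
      ∑ x, c x * (labelValue (g x) : ℤ) = t) x₀ ?_
  · simpa using this
  · intro g hg g' hg' hoff
    simp only [Finset.mem_filter, Finset.mem_univ, true_and] at hg hg'
    have h := linear_determined c x₀ (fun x => (labelValue (g x) : ℤ))
      (fun x => (labelValue (g' x) : ℤ)) fun x hx => by rw [hoff x hx]
    rw [hg, hg', sub_self, eq_comm, mul_eq_zero] at h
    have h' := h.resolve_left hx₀
    exact labelValue_injective (by omega)

/-- The bits of a signed sum over `T` are counted by a middle binomial coefficient. -/
theorem card_signed_subset_sum_le {V : Type} [Fintype V] [DecidableEq V] (c : V → ℤ) (T : Finset V)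
    (hc : ∀ x ∈ T, c x = 1 ∨ c x = -1) (s : ℤ) :
    (T.powerset.filter fun P => ∑ x ∈ P, c x = s).card ≤ T.card.choose (T.card / 2) := by
  classical
  -- Taking the symmetric difference with the negative coordinates turns a signed sum into a
  -- cardinality, so sets of equal signed sum become sets of equal size.
  set Q := T.filter fun x => c x = -1 with hQ
  have hQT : Q ⊆ T := Finset.filter_subset _ _
  have hsize : ∀ P ⊆ T, ((symmDiff P Q).card : ℤ) = ∑ x ∈ P, c x + Q.card := by
    intro P hP
    have h1 : ∑ x ∈ P, c x = ∑ x ∈ P \ Q, c x + ∑ x ∈ P ∩ Q, c x := by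
      rw [add_comm, Finset.sum_inter_add_sum_sdiff]
    have h2 : ∑ x ∈ P \ Q, c x = (P \ Q).card := by
      rw [Finset.card_eq_sum_ones, Nat.cast_sum]
      refine Finset.sum_congr rfl fun x hx => ?_
      simp only [hQ, Finset.mem_sdiff, Finset.mem_filter, not_and] at hx
      rcases hc x (hP hx.1) with h | h
      · simpa using h
      · exact absurd h (hx.2 (hP hx.1))
    have h3 : ∑ x ∈ P ∩ Q, c x = -((P ∩ Q).card : ℤ) := by
      rw [Finset.card_eq_sum_ones, Nat.cast_sum, ← Finset.sum_neg_distrib]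
      refine Finset.sum_congr rfl fun x hx => ?_
      simp only [hQ, Finset.mem_inter, Finset.mem_filter] at hx
      simpa using hx.2.2
    have h4 : (symmDiff P Q).card = (P \ Q).card + (Q \ P).card := by
      rw [symmDiff_def, Finset.sup_eq_union, Finset.card_union_of_disjoint disjoint_sdiff_sdiff]
    have h5 : (Q \ P).card + (P ∩ Q).card = Q.card := by
      rw [Finset.inter_comm, Finset.card_sdiff_add_card_inter]
    rw [h1, h2, h3, h4]
    push_cast
    have : ((Q \ P).card : ℤ) + (P ∩ Q).card = Q.card := by exact_mod_cast h5
    linarith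
  refine le_trans ?_ (Nat.choose_le_middle (s + Q.card).toNat T.card)
  rw [← Finset.card_powersetCard]
  apply Finset.card_le_card_of_injOn (fun P => symmDiff P Q)
  · intro P hP
    simp only [Finset.coe_filter, Finset.mem_powerset, Set.mem_ofPred_eq] at hP
    simp only [Finset.mem_coe, Finset.mem_powersetCard]
    refine ⟨?_, ?_⟩
    · exact symmDiff_le_sup.trans (Finset.union_subset hP.1 hQT)
    · have := hsize P hP.1
      rw [hP.2] at this
      omega
  · intro P _ P' _ h
    exact symmDiff_left_injective Q h

/-- Modulo M only the residues matter, and a coefficient ±1 determines one residue from the others: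
a factor 1/M. Given the residues and the bits off `T`, the bits on `T` have a prescribed signed sum:
a factor `choose`/2^|T|. -/
theorem card_linear_eq_le_choose {V : Type} [Fintype V] [DecidableEq V] {M : ℕ} (c : V → ℤ) (t : ℤ)
    (T : Finset V) (hT : T.Nonempty) (hc : ∀ x ∈ T, c x = 1 ∨ c x = -1) :
    (Finset.univ.filter fun g : V → Bool × Fin M =>
      ∑ x, c x * (labelValue (g x) : ℤ) = t).card * (M * 2 ^ T.card) ≤
        T.card.choose (T.card / 2) * (2 * M) ^ Fintype.card V := by
  classical
  obtain ⟨x₀, hx₀⟩ := hT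
  set S := Finset.univ.filter fun g : V → Bool × Fin M => ∑ x, c x * (labelValue (g x) : ℤ) = t
    with hS
  set Y := Finset.univ.filter fun y : V → Fin M =>
    (M : ℤ) ∣ t - ∑ x, c x * (((y x : ℕ) : ℤ) + 1) with hY
  let bits : (V → Bool × Fin M) → Finset V := fun g => Finset.univ.filter fun x => (g x).1 = true
  have hsplit : ∀ g : V → Bool × Fin M, ∑ x, c x * (labelValue (g x) : ℤ) =
      ∑ x, c x * ((((g x).2 : ℕ) : ℤ) + 1) + M * ∑ x ∈ bits g, c x := by
    intro g
    rw [Finset.sum_filter, Finset.mul_sum, ← Finset.sum_add_distrib]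
    refine Finset.sum_congr rfl fun x _ => ?_
    cases h : (g x).1
    · simp [labelValue, h]
    · simp [labelValue, h]; ring
  have hYcard : Y.card * M ≤ M ^ Fintype.card V := by
    have := card_mul_card_le_of_determined Y x₀ ?_
    · simpa using this
    · intro y hy y' hy' hoff
      simp only [hY, Finset.mem_filter, Finset.mem_univ, true_and] at hy hy'
      have h := linear_determined c x₀ (fun x => ((y x : ℕ) : ℤ) + 1)
        (fun x => ((y' x : ℕ) : ℤ) + 1) fun x hx => by rw [hoff x hx]
      have hdvd : (M : ℤ) ∣ c x₀ * ((((y x₀ : ℕ) : ℤ) + 1) - (((y' x₀ : ℕ) : ℤ) + 1)) := by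
        rw [← h]
        obtain ⟨w, hw⟩ := hy
        obtain ⟨w', hw'⟩ := hy'
        exact ⟨w' - w, by rw [mul_sub, ← hw, ← hw']; ring⟩
      have hdvd' : (M : ℤ) ∣ ((y x₀ : ℕ) : ℤ) - ((y' x₀ : ℕ) : ℤ) := by
        obtain ⟨w, hw⟩ := hdvd
        rcases hc x₀ hx₀ with h1 | h1
        · rw [h1] at hw
          exact ⟨w, by linarith⟩
        · rw [h1] at hw
          exact ⟨-w, by linarith⟩
      have h1 := (y x₀).2
      have h2 := (y' x₀).2
      have := Int.eq_zero_of_abs_lt_dvd hdvd' (by rw [abs_lt]; constructor <;> omega)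
      exact Fin.ext (by omega)
  let φ : (V → Bool × Fin M) → Finset V × (V → Fin M) := fun g =>
    (bits g \ T, fun x => (g x).2)
  have himage : S.image φ ⊆ (Tᶜ).powerset ×ˢ Y := by
    intro p hp
    obtain ⟨g, hg, rfl⟩ := Finset.mem_image.1 hp
    simp only [hS, Finset.mem_filter, Finset.mem_univ, true_and] at hg
    simp only [φ, Finset.mem_product, Finset.mem_powerset, hY, Finset.mem_filter,
      Finset.mem_univ, true_and]
    refine ⟨fun x hx => ?_, ?_⟩
    · rw [Finset.mem_compl]
      exact (Finset.mem_sdiff.1 hx).2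
    · rw [← hg, hsplit g]
      exact ⟨∑ x ∈ bits g, c x, by ring⟩
  have hfib : ∀ p ∈ S.image φ, (S.filter fun g => φ g = p).card ≤
      T.card.choose (T.card / 2) := by
    intro p hp
    obtain ⟨g₀, hg₀, rfl⟩ := Finset.mem_image.1 hp
    refine le_trans ?_ (card_signed_subset_sum_le c T hc (∑ x ∈ bits g₀ ∩ T, c x))
    apply Finset.card_le_card_of_injOn (fun g => bits g ∩ T)
    · intro g hg
      simp only [Finset.coe_filter, Set.mem_ofPred_eq, hS, Finset.mem_filter, Finset.mem_univ,
        true_and, φ, Prod.mk.injEq] at hg hg₀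
      simp only [Finset.coe_filter, Set.mem_ofPred_eq, Finset.mem_powerset]
      refine ⟨Finset.inter_subset_right, ?_⟩
      obtain ⟨h1, h2, h3⟩ := hg
      rw [hsplit] at h1 hg₀
      have hy : ∑ x, c x * ((((g x).2 : ℕ) : ℤ) + 1) = ∑ x, c x * ((((g₀ x).2 : ℕ) : ℤ) + 1) :=
        Finset.sum_congr rfl fun x _ => by rw [congrFun h3 x]
      have hM : (M : ℤ) ≠ 0 := by
        have := (g x₀).2.2
        omega
      have hb : ∑ x ∈ bits g, c x = ∑ x ∈ bits g₀, c x := by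
        apply mul_left_cancel₀ hM
        linarith
      rw [← Finset.sum_inter_add_sum_sdiff (bits g) T, ← Finset.sum_inter_add_sum_sdiff (bits g₀) T,
        h2] at hb
      linarith
    · intro g hg g' hg' h
      simp only [Finset.coe_filter, Set.mem_ofPred_eq, φ, Prod.mk.injEq] at hg hg' h
      have hbits : bits g = bits g' := by
        rw [← Finset.sdiff_union_inter (bits g) T, ← Finset.sdiff_union_inter (bits g') T, h,
          hg.2.1, hg'.2.1]
      funext x
      refine Prod.ext ?_ ?_
      · have := congrArg (fun s => x ∈ s) hbits
        simp only [bits, Finset.mem_filter, Finset.mem_univ, true_and, eq_iff_iff] at this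
        exact Bool.eq_iff_iff.2 this
      · have := congrFun hg.2.2 x
        rw [← congrFun hg'.2.2 x] at this
        exact this
  have h1 := Finset.card_le_mul_card_image S _ hfib
  have h2 := Finset.card_le_card himage
  rw [Finset.card_product, Finset.card_powerset, Finset.card_compl] at h2
  have hTle : T.card ≤ Fintype.card V := Finset.card_le_univ T
  calc S.card * (M * 2 ^ T.card)
      ≤ (T.card.choose (T.card / 2) * (2 ^ (Fintype.card V - T.card) * Y.card)) *
          (M * 2 ^ T.card) := Nat.mul_le_mul_right _ (h1.trans (Nat.mul_le_mul_left _ h2))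
    _ = T.card.choose (T.card / 2) * (2 ^ (Fintype.card V - T.card) * 2 ^ T.card) *
          (Y.card * M) := by ring
    _ ≤ T.card.choose (T.card / 2) * (2 ^ (Fintype.card V - T.card) * 2 ^ T.card) *
          M ^ Fintype.card V := Nat.mul_le_mul_left _ hYcard
    _ = _ := by
      rw [← pow_add, Nat.sub_add_cancel hTle, mul_pow]
      ring

/-- The weight 2h + 1 closes the induction because (2h+1)(2h+3) ≤ 4(h+1)². -/
theorem centralBinom_sq_mul_le (h : ℕ) : h.centralBinom ^ 2 * (2 * h + 1) ≤ 16 ^ h := by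
  induction h with
  | zero => simp
  | succ h ih =>
    have hs := Nat.succ_mul_centralBinom_succ h
    have h1 : (h + 1) ^ 2 * ((h + 1).centralBinom ^ 2 * (2 * (h + 1) + 1)) ≤
        (h + 1) ^ 2 * 16 ^ (h + 1) := by
      calc (h + 1) ^ 2 * ((h + 1).centralBinom ^ 2 * (2 * (h + 1) + 1))
          = ((h + 1) * (h + 1).centralBinom) ^ 2 * (2 * (h + 1) + 1) := by ring
        _ = (h.centralBinom ^ 2 * (2 * h + 1)) * (4 * ((2 * h + 1) * (2 * h + 3))) := by
          rw [hs]; ring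
        _ ≤ 16 ^ h * (4 * (4 * (h + 1) ^ 2)) := by
          refine Nat.mul_le_mul ih (Nat.mul_le_mul_left _ ?_)
          nlinarith
        _ = _ := by ring
    exact Nat.le_of_mul_le_mul_left h1 (by positivity)

/-- Powers of two; this will label the heavy elements. -/
theorem exists_subset_sum_injective {V : Type} [DecidableEq V] (X : Finset V) :
    ∃ w : V → ℕ, (∀ x, 0 < w x ∧ w x ≤ 2 ^ X.card) ∧
      ∀ A ⊆ X, ∀ B ⊆ X, ∑ x ∈ A, w x = ∑ x ∈ B, w x → A = B := by
  let idx : V → ℕ := fun x => if h : x ∈ X then (X.equivFin ⟨x, h⟩ : ℕ) else 0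
  have hidx : Set.InjOn idx X := by
    intro x hx y hy h
    have hx' : x ∈ X := hx
    have hy' : y ∈ X := hy
    simp only [idx, hx', hy', dite_true] at h
    simpa using X.equivFin.injective (Fin.ext h)
  have hle : ∀ x, idx x ≤ X.card := by
    intro x
    by_cases hx : x ∈ X
    · simp only [idx, hx, dite_true]
      exact (X.equivFin ⟨x, hx⟩).2.le
    · simp [idx, hx]
  refine ⟨fun x => 2 ^ idx x, fun x => ⟨by positivity, Nat.pow_le_pow_right two_pos (hle x)⟩, ?_⟩
  intro A hA B hB h
  have hA' : Set.InjOn idx A := hidx.mono hA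
  have hB' : Set.InjOn idx B := hidx.mono hB
  have himg : A.image idx = B.image idx := by
    apply Finset.geomSum_injective (n := 2) le_rfl
    simp only
    rw [Finset.sum_image hA', Finset.sum_image hB']
    exact h
  have hsub : ∀ A ⊆ X, ∀ B ⊆ X, A.image idx = B.image idx → A ⊆ B := by
    intro A hA B hB h x hx
    have h1 : idx x ∈ B.image idx := h ▸ Finset.mem_image_of_mem idx hx
    obtain ⟨y, hy, hyx⟩ := Finset.mem_image.1 h1
    rw [← hidx (hB hy) (hA hx) hyx]
    exact hy
  exact Finset.Subset.antisymm (hsub A hA B hB himg) (hsub B hB A hA himg.symm)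

/-- Since at most half of the 2M values are forbidden, 1 - x/2 ≥ e^(-x) applies with x = a v/M ≤ 1.
-/
theorem pow_mul_exp_neg_le_prod_sub {V : Type} [Fintype V] {M : ℕ} (hM : 0 < M) (a : V → ℕ)
    (ha : ∀ v, a v ≤ M) :
    ((2 * M : ℕ) : ℝ) ^ Fintype.card V * Real.exp (-((∑ v, a v : ℕ) / M)) ≤
      ((∏ v, (2 * M - a v) : ℕ) : ℝ) := by
  have hM' : (0 : ℝ) < M := by exact_mod_cast hM
  have hfac : ∀ v, ((2 * M : ℕ) : ℝ) * Real.exp (-(a v / M)) ≤ ((2 * M - a v : ℕ) : ℝ) := by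
    intro v
    have hav : (a v : ℝ) ≤ M := by exact_mod_cast ha v
    have ha0 : (0 : ℝ) ≤ a v := by positivity
    rw [Nat.cast_sub (by have := ha v; omega)]
    push_cast
    have hpos : (0 : ℝ) < 1 - a v / (2 * M) := by
      rw [sub_pos, div_lt_one (by positivity)]
      linarith
    have hexp : Real.exp (-(a v / M)) ≤ 1 - a v / (2 * M) := by
      rw [← Real.le_log_iff_exp_le hpos]
      refine le_trans ?_ (Real.one_sub_inv_le_log_of_pos hpos)
      have h2 : (1 - a v / (2 * M) : ℝ)⁻¹ = 1 + a v / (2 * M - a v) := by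
        have : (2 * M - a v : ℝ) ≠ 0 := by linarith
        field_simp
        ring
      have h3 : (a v : ℝ) / (2 * M - a v) ≤ a v / M := by
        apply div_le_div_of_nonneg_left ha0 hM'
        linarith
      rw [h2]
      linarith
    calc (2 * M : ℝ) * Real.exp (-(a v / M)) ≤ 2 * M * (1 - a v / (2 * M)) := by gcongr
      _ = 2 * M - a v := by field_simp
  calc ((2 * M : ℕ) : ℝ) ^ Fintype.card V * Real.exp (-((∑ v, a v : ℕ) / M))
      = ∏ v, ((2 * M : ℕ) : ℝ) * Real.exp (-(a v / M)) := by
        rw [Finset.prod_mul_distrib, Finset.prod_const, Finset.card_univ, ← Real.exp_sum,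
          Finset.sum_neg_distrib, ← Finset.sum_div]
        push_cast
        rfl
    _ ≤ ∏ v, ((2 * M - a v : ℕ) : ℝ) :=
        Finset.prod_le_prod (fun v _ => by positivity) fun v _ => hfac v
    _ = _ := by push_cast; rfl

open Classical in
/-- Counting of the labelings that avoid a family of linear equations, each equation being charged
to the last variable occurring in it. -/
theorem prod_sub_le_card_avoiding_linear {V κ : Type} [Fintype V] [LinearOrder V] {M : ℕ}
    (hM : 0 < M) (P : Finset κ) (c : κ → V → ℤ) (t : κ → ℤ) (hc : ∀ p ∈ P, ∃ v, c p v ≠ 0) :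
    ∏ v, (2 * M - (P.filter fun p => c p v ≠ 0 ∧ ∀ x > v, c p x = 0).card) ≤
      (Finset.univ.filter fun g : V → Bool × Fin M =>
        ∀ p ∈ P, ∑ x, c p x * (labelValue (g x) : ℤ) ≠ t p).card := by
  have : Nonempty (Bool × Fin M) := ⟨(true, ⟨0, hM⟩)⟩
  -- An equation forbids a value only at its last variable, where the earlier choices leave at most
  -- one solution.
  let B : V → (V → Bool × Fin M) → Finset (Bool × Fin M) := fun v g =>
    (P.filter fun p => c p v ≠ 0 ∧ ∀ x > v, c p x = 0).biUnion fun p =>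
      Finset.univ.filter fun b =>
        ∑ x, c p x * (labelValue (Function.update g v b x) : ℤ) = t p
  have h := prod_sub_le_card_avoiding B
    (fun v => (P.filter fun p => c p v ≠ 0 ∧ ∀ x > v, c p x = 0).card) ?_ ?_
  · have hcard : Fintype.card (Bool × Fin M) = 2 * M := by simp
    rw [hcard] at h
    refine h.trans (Finset.card_le_card fun g hg => ?_)
    simp only [Finset.mem_filter, Finset.mem_univ, true_and] at hg ⊢
    intro p hp heq
    obtain ⟨v₀, hv₀⟩ := hc p hp
    let s := Finset.univ.filter fun v => c p v ≠ 0
    have hs : s.Nonempty := ⟨v₀, by simpa [s] using hv₀⟩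
    have hmem := s.max'_mem hs
    refine hg (s.max' hs) (Finset.mem_biUnion.2 ⟨p, ?_, ?_⟩)
    · simp only [Finset.mem_filter]
      refine ⟨hp, by simpa [s] using hmem, fun x hx => ?_⟩
      by_contra hne
      exact absurd (s.le_max' x (by simpa [s] using hne)) (not_le.2 hx)
    · simpa using heq
  · intro v g g' hgg
    refine Finset.biUnion_congr rfl fun p hp => Finset.filter_congr fun b _ => ?_
    simp only [Finset.mem_filter] at hp
    have : ∑ x, c p x * (labelValue (Function.update g v b x) : ℤ) =
        ∑ x, c p x * (labelValue (Function.update g' v b x) : ℤ) := by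
      refine Finset.sum_congr rfl fun x _ => ?_
      rcases lt_trichotomy x v with hx | rfl | hx
      · rw [Function.update_of_ne hx.ne, Function.update_of_ne hx.ne, hgg x hx]
      · simp
      · rw [hp.2.2 x hx]; simp
    rw [this]
  · intro v g
    refine (Finset.card_biUnion_le_card_mul _ _ 1 fun p hp => ?_).trans (by rw [mul_one])
    simp only [Finset.mem_filter] at hp
    rw [Finset.card_le_one]
    intro b hb b' hb'
    simp only [Finset.mem_filter, Finset.mem_univ, true_and] at hb hb'
    have h := linear_determined (c p) v (fun x => (labelValue (Function.update g v b x) : ℤ))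
      (fun x => (labelValue (Function.update g v b' x) : ℤ))
      fun x hx => by simp [Function.update_of_ne hx]
    rw [hb, hb', sub_self, eq_comm, mul_eq_zero] at h
    have h' := h.resolve_left hp.2.1
    simp only [Function.update_self] at h'
    exact labelValue_injective (by omega)

/-! ### Upper bound: symmetric differences and heavy elements -/

/-- The coefficients of the difference of the sums over `A` and over `B`. -/
def diffCoeff {V : Type} [DecidableEq V] (A B : Finset V) (x : V) : ℤ :=
  (if x ∈ A then 1 else 0) - (if x ∈ B then 1 else 0)

theorem sum_diffCoeff_mul {V : Type} [Fintype V] [DecidableEq V] (A B : Finset V) (f : V → ℤ) :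
    ∑ x, diffCoeff A B x * f x = ∑ x ∈ A, f x - ∑ x ∈ B, f x := by
  simp only [diffCoeff, sub_mul, Finset.sum_sub_distrib, ite_mul, one_mul, zero_mul,
    Finset.sum_ite_mem, Finset.univ_inter]

theorem diffCoeff_ne_zero_iff {V : Type} [DecidableEq V] (A B : Finset V) (x : V) :
    diffCoeff A B x ≠ 0 ↔ x ∈ symmDiff A B := by
  rw [Finset.mem_symmDiff]
  by_cases h1 : x ∈ A <;> by_cases h2 : x ∈ B <;> simp [diffCoeff, h1, h2]

theorem diffCoeff_eq_or {V : Type} [DecidableEq V] {A B : Finset V} {x : V}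
    (hx : x ∈ symmDiff A B) : diffCoeff A B x = 1 ∨ diffCoeff A B x = -1 := by
  rw [Finset.mem_symmDiff] at hx
  by_cases h1 : x ∈ A <;> by_cases h2 : x ∈ B <;> simp_all [diffCoeff]

/-- The elements lying in more than `M` symmetric differences of size at most `D`. -/
def heavyElements {V ι : Type} [Fintype V] [DecidableEq V] [Fintype ι] (E : ι → Finset V)
    (D M : ℕ) : Finset V :=
  Finset.univ.filter fun x => M < (Finset.univ.filter fun p : ι × ι =>
    (symmDiff (E p.1) (E p.2)).card ≤ D ∧ x ∈ symmDiff (E p.1) (E p.2)).card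

/-- Double counting: each pair contributes at most D incidences, and each heavy element absorbs more
than M of them. -/
theorem card_heavyElements_le {V ι : Type} [Fintype V] [DecidableEq V] [Fintype ι] (E : ι → Finset V)
    {C D M : ℕ} (hM0 : 0 < M) (hM : Fintype.card ι ^ 2 ≤ 4 * C * M) :
    (heavyElements E D M).card ≤ 4 * C * D := by
  have h1 : (heavyElements E D M).card * M ≤ ∑ x : V, (Finset.univ.filter fun p : ι × ι =>
      (symmDiff (E p.1) (E p.2)).card ≤ D ∧ x ∈ symmDiff (E p.1) (E p.2)).card := by
    rw [← smul_eq_mul]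
    refine (Finset.card_nsmul_le_sum _ (fun x => (Finset.univ.filter fun p : ι × ι =>
      (symmDiff (E p.1) (E p.2)).card ≤ D ∧ x ∈ symmDiff (E p.1) (E p.2)).card) _
      fun x hx => ?_).trans (Finset.sum_le_univ_sum_of_nonneg fun _ => Nat.zero_le _)
    exact (Finset.mem_filter.1 hx).2.le
  have h2 : ∑ x : V, (Finset.univ.filter fun p : ι × ι =>
      (symmDiff (E p.1) (E p.2)).card ≤ D ∧ x ∈ symmDiff (E p.1) (E p.2)).card ≤
      Fintype.card ι ^ 2 * D := by
    simp only [Finset.card_filter]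
    rw [Finset.sum_comm]
    have : ∀ p : ι × ι, (∑ x : V, if (symmDiff (E p.1) (E p.2)).card ≤ D ∧
        x ∈ symmDiff (E p.1) (E p.2) then 1 else 0) ≤ D := by
      intro p
      by_cases hp : (symmDiff (E p.1) (E p.2)).card ≤ D
      · simp [hp]
      · simp [hp]
    refine (Finset.sum_le_card_nsmul _ _ D fun p _ => this p).trans (le_of_eq ?_)
    simp [sq]
  have h3 : (heavyElements E D M).card * M ≤ (4 * C * D) * M := by
    calc _ ≤ Fintype.card ι ^ 2 * D := h1.trans h2
      _ ≤ (4 * C * M) * D := Nat.mul_le_mul_right _ hM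
      _ = _ := by ring
  exact Nat.le_of_mul_le_mul_right h3 hM0

open Classical in
-- An equation has at most one last variable.
theorem sum_card_last_le {V κ : Type} [Fintype V] [LinearOrder V] (P : Finset κ)
    (c : κ → V → ℤ) :
    ∑ v, (P.filter fun p => c p v ≠ 0 ∧ ∀ x > v, c p x = 0).card ≤ P.card := by
  simp only [Finset.card_filter]
  rw [Finset.sum_comm, Finset.card_eq_sum_ones]
  refine Finset.sum_le_sum fun p _ => ?_
  rw [← Finset.card_filter, Finset.card_le_one]
  intro v hv v' hv'
  simp only [Finset.mem_filter, Finset.mem_univ, true_and] at hv hv'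
  by_contra hne
  rcases lt_or_gt_of_ne hne with h | h
  · exact hv'.1 (hv.2 v' h)
  · exact hv.1 (hv'.2 v h)

/-- A set family with `m` members has a labeling by `1, …, 2 M` with distinct sums on distinct
members, where `2 M` is of the order of `m ^ 2 / C`, provided few of the symmetric differences have
size between `D` and `(4 C + 1) D`. -/
theorem exists_labeling_distinct_sums {V ι : Type} [Fintype V] [LinearOrder V] [Fintype ι]
    (E : ι → Finset V) {C D T M : ℕ} (hM0 : 0 < M) (hD0 : 0 < D) (hT0 : 0 < T)
    (hM : Fintype.card ι ^ 2 ≤ 4 * C * M) (hpow : 2 ^ (4 * C * D) ≤ 2 * M)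
    (hmid : T * (Finset.univ.filter fun p : ι × ι => D < (symmDiff (E p.1) (E p.2)).card ∧
      (symmDiff (E p.1) (E p.2)).card ≤ (4 * C + 1) * D).card ≤ Fintype.card ι ^ 2)
    (hconst : (2 * C / T + 4 * C * (D.choose (D / 2) / 2 ^ D) : ℝ) < Real.exp (-(4 * C))) :
    ∃ f : V → ℕ, (∀ v, 0 < f v ∧ f v ≤ 2 * M) ∧
      ∀ u v, E u ≠ E v → ∑ x ∈ E u, f x ≠ ∑ x ∈ E v, f x := by
  classical
  set n := Fintype.card V with hn
  set m := Fintype.card ι with hm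
  have hM' : (0 : ℝ) < M := by exact_mod_cast hM0
  have hT' : (0 : ℝ) < T := by exact_mod_cast hT0
  have hmM : (m : ℝ) ^ 2 ≤ 4 * C * M := by exact_mod_cast hM
  set X := heavyElements E D M with hX
  have hXcard : X.card ≤ 4 * C * D := card_heavyElements_le E hM0 hM
  obtain ⟨w, hw, hwinj⟩ := exists_subset_sum_injective X
  let diff : ι × ι → Finset V := fun p => symmDiff (E p.1) (E p.2)
  -- Labels on `X` are fixed to `w`, so their contribution moves to the right-hand side `t`.
  let c : ι × ι → V → ℤ := fun p x => if x ∈ X then 0 else diffCoeff (E p.1) (E p.2) x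
  let t : ι × ι → ℤ := fun p => -∑ x ∈ X, diffCoeff (E p.1) (E p.2) x * (w x : ℤ)
  have hc : ∀ p x, c p x ≠ 0 ↔ x ∈ diff p \ X := by
    intro p x
    by_cases hx : x ∈ X
    · simp [c, hx]
    · simp only [c, hx, if_false, Finset.mem_sdiff, not_false_eq_true, and_true]
      exact diffCoeff_ne_zero_iff _ _ _
  let f : (V → Bool × Fin M) → V → ℕ := fun g x => if x ∈ X then w x else labelValue (g x)
  have hf : ∀ g p, ∑ x ∈ E p.1, f g x = ∑ x ∈ E p.2, f g x →
      ∑ x, c p x * (labelValue (g x) : ℤ) = t p := by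
    intro g p h
    have h1 := sum_diffCoeff_mul (E p.1) (E p.2) (fun x => (f g x : ℤ))
    have h2 : ∑ x ∈ E p.1, (f g x : ℤ) = ∑ x ∈ E p.2, (f g x : ℤ) := by exact_mod_cast h
    rw [h2, sub_self] at h1
    have h3 : ∑ x ∈ X, diffCoeff (E p.1) (E p.2) x * (w x : ℤ) =
        ∑ x, if x ∈ X then diffCoeff (E p.1) (E p.2) x * (w x : ℤ) else 0 := by
      rw [Finset.sum_ite_mem, Finset.univ_inter]
    have h4 : ∑ x, diffCoeff (E p.1) (E p.2) x * (f g x : ℤ) =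
        ∑ x, c p x * (labelValue (g x) : ℤ) +
          ∑ x ∈ X, diffCoeff (E p.1) (E p.2) x * (w x : ℤ) := by
      rw [h3, ← Finset.sum_add_distrib]
      refine Finset.sum_congr rfl fun x _ => ?_
      by_cases hx : x ∈ X <;> simp [c, f, hx]
    simp only [t]
    linarith
  let Hit : ι × ι → Finset (V → Bool × Fin M) := fun p =>
    Finset.univ.filter fun g => ∑ x, c p x * (labelValue (g x) : ℤ) = t p
  let Small := Finset.univ.filter fun p : ι × ι => (diff p).card ≤ D ∧ (diff p \ X).Nonempty
  let Mid := Finset.univ.filter fun p : ι × ι =>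
    (D < (diff p).card ∧ (diff p).card ≤ (4 * C + 1) * D) ∧ (diff p \ X).Nonempty
  let Large := Finset.univ.filter fun p : ι × ι => (4 * C + 1) * D < (diff p).card
  have hpairs : ∀ Q : Finset (ι × ι), (Q.card : ℝ) ≤ (m : ℝ) ^ 2 := by
    intro Q
    have : Q.card ≤ m ^ 2 := by
      refine (Finset.card_le_univ Q).trans (le_of_eq ?_)
      simp [hm, sq]
    exact_mod_cast this
  set Nn : ℝ := ((2 * M : ℕ) : ℝ) ^ n with hNn
  have hNn0 : 0 < Nn := by positivity
  set Good := Finset.univ.filter fun g : V → Bool × Fin M =>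
    ∀ p ∈ Small, ∑ x, c p x * (labelValue (g x) : ℤ) ≠ t p with hGood
  have hgood : Nn * Real.exp (-(4 * C)) ≤ (Good.card : ℝ) := by
    have h1 := prod_sub_le_card_avoiding_linear hM0 Small c t (by
      intro p hp
      obtain ⟨v, hv⟩ := (Finset.mem_filter.1 hp).2.2
      exact ⟨v, (hc p v).2 hv⟩)
    -- No equation involves a heavy variable, and a light one lies in at most M small differences.
    have h2 : ∀ v, (Small.filter fun p => c p v ≠ 0 ∧ ∀ x > v, c p x = 0).card ≤ M := by
      intro v
      by_cases hv : v ∈ X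
      · rw [Finset.filter_false_of_mem, Finset.card_empty]
        · exact Nat.zero_le _
        · intro p _ h
          exact (Finset.mem_sdiff.1 ((hc p v).1 h.1)).2 hv
      · have hv' := hv
        simp only [hX, heavyElements, Finset.mem_filter, Finset.mem_univ, true_and, not_lt] at hv'
        refine le_trans (Finset.card_le_card ?_) hv'
        intro p hp
        simp only [Small, Finset.mem_filter, Finset.mem_univ, true_and] at hp ⊢
        exact ⟨hp.1.1, (Finset.mem_sdiff.1 ((hc p v).1 hp.2.1)).1⟩
    have h3 := pow_mul_exp_neg_le_prod_sub hM0 _ h2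
    have h4 := sum_card_last_le Small c
    refine le_trans ?_ (h3.trans (Nat.cast_le.2 (h1.trans (le_of_eq ?_))))
    swap
    · rw [hGood]
      congr!
    refine mul_le_mul_of_nonneg_left (Real.exp_le_exp.2 (neg_le_neg ?_)) hNn0.le
    rw [div_le_iff₀ hM']
    refine le_trans ?_ hmM
    exact le_trans (Nat.cast_le.2 h4) (hpairs Small)
  have hmidsum : ((Mid.biUnion Hit).card : ℝ) ≤ 2 * C / T * Nn := by
    have h1 : (Mid.biUnion Hit).card * (2 * M) ≤ Mid.card * (2 * M) ^ n := by
      calc (Mid.biUnion Hit).card * (2 * M) ≤ (∑ p ∈ Mid, (Hit p).card) * (2 * M) :=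
            Nat.mul_le_mul_right _ Finset.card_biUnion_le
        _ = ∑ p ∈ Mid, (Hit p).card * (2 * M) := Finset.sum_mul _ _ _
        _ ≤ Mid.card • (2 * M) ^ n := by
            refine Finset.sum_le_card_nsmul _ _ _ fun p hp => ?_
            obtain ⟨v, hv⟩ := (Finset.mem_filter.1 hp).2.2
            exact card_linear_eq_le (c p) (t p) ((hc p v).2 hv)
        _ = _ := by rw [smul_eq_mul]
    have h2 : T * Mid.card ≤ m ^ 2 := by
      refine le_trans (Nat.mul_le_mul_left _ (Finset.card_le_card ?_)) hmid
      intro p hp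
      simp only [Mid, Finset.mem_filter, Finset.mem_univ, true_and] at hp ⊢
      exact hp.1
    have h1' : ((Mid.biUnion Hit).card : ℝ) * (2 * M) ≤ Mid.card * Nn := by
      rw [hNn]; exact_mod_cast h1
    have h2' : (T : ℝ) * Mid.card ≤ (m : ℝ) ^ 2 := by exact_mod_cast h2
    have h5 : (Mid.card : ℝ) ≤ 4 * C * M / T := by
      rw [le_div_iff₀ hT']
      linarith
    rw [← le_div_iff₀ (by positivity)] at h1'
    calc ((Mid.biUnion Hit).card : ℝ) ≤ Mid.card * Nn / (2 * M) := h1'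
      _ ≤ (4 * C * M / T) * Nn / (2 * M) := by gcongr
      _ = _ := by field_simp; ring
  have hlargesum : ((Large.biUnion Hit).card : ℝ) ≤
      4 * C * (D.choose (D / 2) / 2 ^ D) * Nn := by
    have h1 : (Large.biUnion Hit).card * (M * 2 ^ D) ≤
        Large.card * (D.choose (D / 2) * (2 * M) ^ n) := by
      calc (Large.biUnion Hit).card * (M * 2 ^ D) ≤ (∑ p ∈ Large, (Hit p).card) * (M * 2 ^ D) :=
            Nat.mul_le_mul_right _ Finset.card_biUnion_le
        _ = ∑ p ∈ Large, (Hit p).card * (M * 2 ^ D) := Finset.sum_mul _ _ _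
        _ ≤ Large.card • (D.choose (D / 2) * (2 * M) ^ n) := by
            refine Finset.sum_le_card_nsmul _ _ _ fun p hp => ?_
            have hlarge := (Finset.mem_filter.1 hp).2
            -- Removing at most 4CD heavy elements from more than (4C+1)D leaves D; this is why the
            -- middle range ends there.
            have hcard : D ≤ (diff p \ X).card := by
              have := Finset.le_card_sdiff X (diff p)
              have hexpand : (4 * C + 1) * D = 4 * C * D + D := by ring
              omega
            obtain ⟨S, hS, hScard⟩ := Finset.exists_subset_card_eq hcard
            have := card_linear_eq_le_choose (M := M) (c p) (t p) S
              (Finset.card_pos.1 (by omega)) (by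
                intro x hx
                have hx' := Finset.mem_sdiff.1 (hS hx)
                simp only [c, hx'.2, if_false]
                exact diffCoeff_eq_or hx'.1)
            rwa [hScard] at this
        _ = _ := by rw [smul_eq_mul]
    have h1' : ((Large.biUnion Hit).card : ℝ) * (M * 2 ^ D) ≤
        Large.card * (D.choose (D / 2) * Nn) := by
      rw [hNn]; exact_mod_cast h1
    rw [← le_div_iff₀ (by positivity)] at h1'
    have h5 : (Large.card : ℝ) ≤ 4 * C * M := (hpairs Large).trans hmM
    calc ((Large.biUnion Hit).card : ℝ) ≤ Large.card * (D.choose (D / 2) * Nn) / (M * 2 ^ D) := h1'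
      _ ≤ 4 * C * M * (D.choose (D / 2) * Nn) / (M * 2 ^ D) := by gcongr
      _ = _ := by field_simp
  obtain ⟨g, hg, hgmid, hglarge⟩ : ∃ g ∈ Good, g ∉ Mid.biUnion Hit ∧ g ∉ Large.biUnion Hit := by
    by_contra hcon
    push Not at hcon
    have hsub : Good ⊆ Mid.biUnion Hit ∪ Large.biUnion Hit := by
      intro g hg
      rw [Finset.mem_union, or_iff_not_imp_left]
      exact hcon g hg
    have h1 := (Finset.card_le_card hsub).trans (Finset.card_union_le _ _)
    have h2 : (Good.card : ℝ) ≤ (Mid.biUnion Hit).card + (Large.biUnion Hit).card := by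
      exact_mod_cast h1
    have h3 := mul_lt_mul_of_pos_left hconst hNn0
    linarith
  refine ⟨f g, fun v => ?_, fun u v huv heq => ?_⟩
  · by_cases hv : v ∈ X
    · simp only [f, hv, if_true]
      refine ⟨(hw v).1, (hw v).2.trans (le_trans ?_ hpow)⟩
      exact Nat.pow_le_pow_right two_pos hXcard
    · simp only [f, hv, if_false]
      exact ⟨labelValue_pos _, labelValue_le _⟩
  · have hsum := hf g (u, v) heq
    have hhit : g ∈ Hit (u, v) := by simpa [Hit] using hsum
    by_cases hne : (diff (u, v) \ X).Nonempty
    · rcases le_or_gt (diff (u, v)).card D with h1 | h1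
      · exact (Finset.mem_filter.1 hg).2 (u, v)
          (Finset.mem_filter.2 ⟨Finset.mem_univ _, h1, hne⟩) hsum
      rcases le_or_gt (diff (u, v)).card ((4 * C + 1) * D) with h2 | h2
      · exact hgmid (Finset.mem_biUnion.2 ⟨(u, v),
          Finset.mem_filter.2 ⟨Finset.mem_univ _, ⟨h1, h2⟩, hne⟩, hhit⟩)
      · exact hglarge (Finset.mem_biUnion.2 ⟨(u, v),
          Finset.mem_filter.2 ⟨Finset.mem_univ _, h2⟩, hhit⟩)
    -- Here the two sets differ only inside `X`, where the powers of two separate them.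
    · rw [Finset.not_nonempty_iff_eq_empty, Finset.sdiff_eq_empty_iff_subset] at hne
      have hout : E u \ X = E v \ X := by
        ext x
        simp only [Finset.mem_sdiff]
        refine and_congr_left fun hx => ?_
        by_contra hiff
        refine hx (hne ?_)
        rw [Finset.mem_symmDiff]
        tauto
      have hin : ∑ x ∈ E u ∩ X, f g x = ∑ x ∈ E v ∩ X, f g x := by
        rw [← Finset.sum_inter_add_sum_sdiff (E u) X, ← Finset.sum_inter_add_sum_sdiff (E v) X,
          hout] at heq
        exact Nat.add_right_cancel heq
      have hfw : ∀ A : Finset V, ∑ x ∈ A ∩ X, f g x = ∑ x ∈ A ∩ X, w x := fun A =>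
        Finset.sum_congr rfl fun x hx => by simp [f, (Finset.mem_inter.1 hx).2]
      rw [hfw, hfw] at hin
      have := hwinj _ Finset.inter_subset_right _ Finset.inter_subset_right hin
      apply huv
      rw [← Finset.sdiff_union_inter (E u) X, ← Finset.sdiff_union_inter (E v) X, hout, this]

/-! ### Upper bound: choice of constants and scale -/

theorem centralBinom_div_le (h : ℕ) :
    ((2 * h).choose (2 * h / 2) / 2 ^ (2 * h) : ℝ) ≤ 1 / Real.sqrt (2 * h + 1) := by
  have h1 : ((h.centralBinom : ℝ)) ^ 2 * (2 * h + 1) ≤ (4 ^ h) ^ 2 := by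
    have := centralBinom_sq_mul_le h
    rw [← pow_mul, mul_comm h 2, pow_mul]
    norm_num
    exact_mod_cast this
  rw [Nat.mul_div_cancel_left h two_pos, ← Nat.centralBinom_eq_two_mul_choose, pow_mul,
    div_le_div_iff₀ (by positivity) (by positivity), one_mul]
  norm_num
  refine abs_le_of_sq_le_sq' ?_ (by positivity) |>.2
  rw [mul_pow, Real.sq_sqrt (by positivity)]
  exact h1

theorem eventually_sStar_le (C : ℕ) (hC : 0 < C) :
    ∀ᶠ n : ℕ in atTop, (sStar n : ℝ) ≤ (n : ℝ) ^ 2 / C := by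
  have hC' : (0 : ℝ) < C := by exact_mod_cast hC
  set δ := Real.exp (-(4 * C)) with hδ
  have hδ0 : 0 < δ := Real.exp_pos _
  -- `T` makes the middle term less than δ/2, and `h` below makes the large term at most δ/2 at
  -- every scale.
  obtain ⟨T, hT⟩ := exists_nat_gt (4 * C / δ)
  have hT' : (0 : ℝ) < T := lt_trans (by positivity) hT
  have hT0 : 0 < T := by exact_mod_cast hT'
  obtain ⟨h, hh⟩ := exists_nat_gt ((8 * C / δ) ^ 2)
  have hh0 : 0 < h := by
    have : (0 : ℝ) < h := lt_of_le_of_lt (by positivity) hh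
    exact_mod_cast this
  set K := 4 * C + 1 with hK
  let D : ℕ → ℕ := fun i => 2 * (h * K ^ i)
  have hDmono : StrictMono D := by
    refine strictMono_nat_of_lt_succ fun i => ?_
    have : 0 < h * K ^ i := by positivity
    simp only [D, pow_succ]
    nlinarith
  have hDsucc : ∀ i, D (i + 1) = (4 * C + 1) * D i := by
    intro i
    simp only [D, pow_succ, hK]
    ring
  have hconst : ∀ i, (2 * C / T + 4 * C * ((D i).choose (D i / 2) / 2 ^ (D i)) : ℝ) < δ := by
    intro i
    have h1 : (2 * C / T : ℝ) < δ / 2 := by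
      rw [div_lt_iff₀ hδ0] at hT
      rw [div_lt_iff₀ hT']
      linarith
    have h2 := centralBinom_div_le (h * K ^ i)
    have h3 : (8 * C / δ : ℝ) < Real.sqrt (2 * (h * K ^ i : ℕ) + 1) := by
      apply Real.lt_sqrt_of_sq_lt
      have h4 : h ≤ h * K ^ i := Nat.le_mul_of_pos_right _ (by positivity)
      have h5 : (h : ℝ) ≤ (h * K ^ i : ℕ) := by exact_mod_cast h4
      linarith
    have h6 : (1 / Real.sqrt (2 * (h * K ^ i : ℕ) + 1) : ℝ) ≤ 1 / (8 * C / δ) :=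
      one_div_le_one_div_of_le (by positivity) h3.le
    have h7 : (4 * C * ((D i).choose (D i / 2) / 2 ^ (D i)) : ℝ) ≤ 4 * C * (1 / (8 * C / δ)) :=
      mul_le_mul_of_nonneg_left (h2.trans h6) (by positivity)
    have h8 : (4 * C * (1 / (8 * C / δ)) : ℝ) = δ / 2 := by field_simp; norm_num
    linarith
  filter_upwards [eventually_ge_atTop (4 * C + 2 * C * 2 ^ (4 * C * D T))] with n hn
  have hn1 : 1 ≤ n := by omega
  -- The floor gives 2M ≤ n²/C, and M ≥ 1 then costs only a factor 2: n² ≤ 4CM.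
  set M := n ^ 2 / (2 * C) with hMdef
  have hnsq : n ≤ n ^ 2 := Nat.le_self_pow (by norm_num) n
  have hMup : 2 * C * M ≤ n ^ 2 := Nat.mul_div_le _ _
  have hMlow : n ^ 2 < 2 * C * (M + 1) := Nat.lt_mul_div_succ _ (by positivity)
  have hMpow : 2 ^ (4 * C * D T) ≤ M := by
    rw [hMdef, Nat.le_div_iff_mul_le (by positivity)]
    calc 2 ^ (4 * C * D T) * (2 * C) = 2 * C * 2 ^ (4 * C * D T) := by ring
      _ ≤ n ^ 2 := by omega
  have hM1 : 1 ≤ M := le_trans (Nat.one_le_two_pow) hMpow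
  have hM : n ^ 2 ≤ 4 * C * M := by nlinarith
  refine le_trans (b := ((2 * M : ℕ) : ℝ)) ?_ ?_
  · refine Nat.cast_le.2 (Finset.sup_le fun G _ => ?_)
    let E : Fin n → Finset (Fin n) := closedNeighborhood G
    let lev : ℕ → Finset (Fin n × Fin n) := fun i =>
      Finset.univ.filter fun p => D i < (symmDiff (E p.1) (E p.2)).card ∧
        (symmDiff (E p.1) (E p.2)).card ≤ (4 * C + 1) * D i
    -- The T windows (D i, D (i+1)] are disjoint, so one contains at most n²/T pairs.
    obtain ⟨i, hi, hlev⟩ : ∃ i < T, T * (lev i).card ≤ n ^ 2 := by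
      by_contra hcon
      push Not at hcon
      have hdisj : Set.PairwiseDisjoint (Finset.range T : Set ℕ) lev := by
        have : ∀ i j, i < j → Disjoint (lev i) (lev j) := by
          intro i j hij
          rw [Finset.disjoint_left]
          intro p hp hp'
          have h1 := (Finset.mem_filter.1 hp).2.2
          have h2 := (Finset.mem_filter.1 hp').2.1
          rw [← hDsucc] at h1
          have h3 := hDmono.monotone (Nat.succ_le_of_lt hij)
          have h4 : D (i + 1) ≤ D j := h3
          omega
        intro i _ j _ hij
        rcases lt_or_gt_of_ne hij with h | h
        · exact this i j h
        · exact (this j i h).symm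
      have h1 : ∑ i ∈ Finset.range T, (lev i).card ≤ n ^ 2 := by
        rw [← Finset.card_biUnion hdisj]
        refine (Finset.card_le_univ _).trans (le_of_eq ?_)
        simp [sq]
      have h2 : ∑ _i ∈ Finset.range T, n ^ 2 < ∑ i ∈ Finset.range T, T * (lev i).card :=
        Finset.sum_lt_sum_of_nonempty (Finset.nonempty_range_iff.2 hT0.ne')
          fun i hi => hcon i (Finset.mem_range.1 hi)
      rw [← Finset.mul_sum, Finset.sum_const, Finset.card_range, smul_eq_mul] at h2
      exact absurd (Nat.lt_of_mul_lt_mul_left h2) (not_lt.2 h1)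
    have hDi0 : 0 < D i := by
      simp only [D]
      positivity
    obtain ⟨f, hf, hdist⟩ := exists_labeling_distinct_sums E (C := C) (D := D i) (T := T)
      (M := M) hM1 hDi0 hT0 (by simpa using hM)
      ((Nat.pow_le_pow_right two_pos (Nat.mul_le_mul_left _ (hDmono.monotone hi.le))).trans
        (hMpow.trans (by omega)))
      (by simpa using hlev) (hconst i)
    have : Nonempty (Fin n) := ⟨⟨0, hn1⟩⟩
    obtain ⟨v, hv⟩ := Finite.exists_max f
    refine ((sStarGraph_isLeast G).2 ⟨f, ⟨fun v => (hf v).1, hdist⟩, ⟨v, rfl⟩, ?_⟩).trans (hf v).2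
    rintro _ ⟨u, rfl⟩
    exact hv u
  · rw [le_div_iff₀ hC']
    have : ((2 * C * M : ℕ) : ℝ) ≤ ((n ^ 2 : ℕ) : ℝ) := Nat.cast_le.2 hMup
    push_cast at this ⊢
    linarith

/-! ### Real parameters and the function w -/

theorem sStar_pos {n : ℕ} (hn : 0 < n) : 0 < sStar n := by
  have : Nonempty (Fin n) := ⟨⟨0, hn⟩⟩
  refine lt_of_lt_of_le ?_ (sStarGraph_le_sStar (⊥ : SimpleGraph (Fin n)))
  obtain ⟨f, hf, ⟨v, hv⟩, -⟩ := (sStarGraph_isLeast (⊥ : SimpleGraph (Fin n))).1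
  rw [← hv]
  exact hf.1 v

theorem eventually_sStar_le_of_pos {C : ℝ} (hC : 0 < C) :
    ∀ᶠ n : ℕ in atTop, (sStar n : ℝ) ≤ (n : ℝ) ^ 2 / C := by
  obtain ⟨c, hc⟩ := exists_nat_gt C
  have hc0 : 0 < c := by exact_mod_cast hC.trans hc
  filter_upwards [eventually_sStar_le c hc0] with n hn
  exact hn.trans (div_le_div_of_nonneg_left (by positivity) hC hc.le)

theorem eventually_rpow_le_sStar_of_pos {ε : ℝ} (hε : 0 < ε) :
    ∀ᶠ n : ℕ in atTop, (n : ℝ) ^ (2 - ε) ≤ (sStar n : ℝ) := by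
  -- Larger ε only weakens the bound, so ε may be capped at 1.
  filter_upwards [eventually_rpow_le_sStar (lt_min hε one_pos) (min_le_right ε 1),
    eventually_ge_atTop 1] with n hn hn1
  refine le_trans (Real.rpow_le_rpow_of_exponent_le (by exact_mod_cast hn1) ?_) hn
  linarith [min_le_left ε 1]

end SumDistinguishing

theorem corollary2 :
    (∀ C : ℝ, 0 < C → ∀ ε : ℝ, 0 < ε → ∃ n₀ : ℕ, ∀ n : ℕ, n₀ < n →
      (n : ℝ) ^ (2 - ε) ≤ (SumDistinguishing.sStar n : ℝ) ∧
        (SumDistinguishing.sStar n : ℝ) ≤ (n : ℝ) ^ 2 / C) ∧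
    (∃ w : ℕ → ℝ,
      (∀ n : ℕ, 0 < n → 0 < w n ∧ (SumDistinguishing.sStar n : ℝ) = (n : ℝ) ^ 2 / w n) ∧
      Tendsto w atTop atTop ∧
      ∀ ε : ℝ, 0 < ε → w =o[atTop] (fun n : ℕ => (n : ℝ) ^ ε)) := by
  refine ⟨fun C hC ε hε => ?_, fun n => (n : ℝ) ^ 2 / SumDistinguishing.sStar n,
    fun n hn => ?_, ?_, fun ε hε => ?_⟩
  · obtain ⟨n₀, h⟩ := eventually_atTop.1 ((SumDistinguishing.eventually_rpow_le_sStar_of_pos hε).and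
      (SumDistinguishing.eventually_sStar_le_of_pos hC))
    exact ⟨n₀, fun n hn => h n hn.le⟩
  · have hs : (0 : ℝ) < SumDistinguishing.sStar n := by
      exact_mod_cast SumDistinguishing.sStar_pos hn
    have hn' : (0 : ℝ) < n := by exact_mod_cast hn
    exact ⟨by positivity, by field_simp⟩
  · refine tendsto_atTop.2 fun b => ?_
    filter_upwards [SumDistinguishing.eventually_sStar_le_of_pos (lt_max_of_lt_right one_pos :
      (0 : ℝ) < max b 1), eventually_gt_atTop 0] with n hn hn0
    have hs : (0 : ℝ) < SumDistinguishing.sStar n := by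
      exact_mod_cast SumDistinguishing.sStar_pos hn0
    rw [le_div_iff₀ (lt_max_of_lt_right one_pos)] at hn
    rw [le_div_iff₀ hs]
    nlinarith [le_max_left b 1]
  -- The lower bound with ε/2 gives w = O(n^(ε/2)), hence o(n^ε).
  · have hlittle : (fun n : ℕ => (n : ℝ) ^ (ε / 2)) =o[atTop] (fun n : ℕ => (n : ℝ) ^ ε) := by
      refine (isLittleO_iff_tendsto' ?_).2 ?_
      · filter_upwards [eventually_gt_atTop 0] with n hn h0
        have hn' : (0 : ℝ) < n := by exact_mod_cast hn
        exact absurd h0 (Real.rpow_pos_of_pos hn' _).ne'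
      · refine ((tendsto_rpow_neg_atTop (half_pos hε)).comp
          tendsto_natCast_atTop_atTop).congr' ?_
        filter_upwards [eventually_gt_atTop 0] with n hn
        have hn' : (0 : ℝ) < n := by exact_mod_cast hn
        rw [Function.comp, ← Real.rpow_sub hn']
        congr 1
        ring
    refine IsBigO.trans_isLittleO (IsBigO.of_bound 1 ?_) hlittle
    filter_upwards [SumDistinguishing.eventually_rpow_le_sStar_of_pos (half_pos hε),
      eventually_gt_atTop 0] with n hn hn0
    have hs : (0 : ℝ) < SumDistinguishing.sStar n := by
      exact_mod_cast SumDistinguishing.sStar_pos hn0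
    have hn' : (0 : ℝ) < n := by exact_mod_cast hn0
    rw [Real.norm_of_nonneg (by positivity), Real.norm_of_nonneg (by positivity), one_mul,
      div_le_iff₀ hs]
    calc (n : ℝ) ^ 2 = (n : ℝ) ^ (ε / 2) * (n : ℝ) ^ (2 - ε / 2) := by
          rw [← Real.rpow_add hn', ← Real.rpow_natCast]
          congr 1
          push_cast
          ring
      _ ≤ _ := by gcongr
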